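/- Let $d,r\ge 0$ be integers, let $[0,1]^d$ be the unit cube, let $m_d$ be Lebesgue measure on the Borel subsets of $[0,1]^d$, and let $\lambda_d$ be the completion of $m_d$, whose domain is the class of Lebesgue measurable subsets of $[0,1]^d$. For $A\subset[0,1]^d$ and $K\subset\{1,\dots,d\}$ put $$[A]_K:=\{\omega\in[0,1]^d : \text{every } \omega'\in[0,1]^d \text{ with } \omega'_i=\omega_i \text{ for all } i\in K \text{ lies in } A\},$$ and for $A_1,\dots,A_r\subset[0,1]^d$ define the $r$-fold BKR product $$\mathop{\square}_{i=1}^{r}A_i:=\bigcup_{J_1,\dots,J_r}\ [A_1]_{J_1}\cap[A_2]_{J_2}\cap\cdots\cap[A_r]_{J_r},$$ where the union is over all pairwise disjoint (possibly empty) subsets $J_1,\dots,J_r$ of $\{1,\dots,d\}$. (For $r=0$ the empty intersection is $[0,1]^d$ and empty products equal $1$.) **Theorem.** 1. If $A_1,\dots,A_r\subset[0,1]^d$ are Borel sets, then $\mathop{\square}_{i=1}^{r}A_i$ is Lebesgue measurable and $$\lambda_d\Bigl(\mathop{\square}_{i=1}^{r}A_i\Bigr)\le\prod_{i=1}^{r}m_d(A_i).$$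 2. If $A_1,\dots,A_r\subset[0,1]^d$ are Lebesgue measurable, then there exists a Borel set $D\subset[0,1]^d$ with $$\mathop{\square}_{i=1}^{r}A_i\subset D\qquad\text{and}\qquad m_d(D)\le\prod_{i=1}^{r}\lambda_d(A_i).$$ -/

import Mathlib

open MeasureTheory

namespace BKR

/-- The thin cylinder `Cyl(K, ω)`: all points of `S^d` that agree with `ω` on the coordinates
in `K`. -/
def cyl {S : Type*} {d : ℕ} (K : Finset (Fin d)) (ω : Fin d → S) : Set (Fin d → S) :=
  {ω' | ∀ i ∈ K, ω' i = ω i}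

/-- `[A]_K`: the largest cylinder set contained in `A` and free in the directions outside `K`. -/
def maxCyl {S : Type*} {d : ℕ} (A : Set (Fin d → S)) (K : Finset (Fin d)) : Set (Fin d → S) :=
  {ω | cyl K ω ⊆ A}

/-- The simultaneous `r`-fold BKR operator: the union of `[A_1]_{J_1} ∩ ⋯ ∩ [A_r]_{J_r}` over all
pairwise disjoint (possibly empty) sets `J_1, …, J_r` of coordinates. -/
def bkr {S : Type*} {d r : ℕ} (A : Fin r → Set (Fin d → S)) : Set (Fin d → S) :=
  ⋃ (J : Fin r → Finset (Fin d)) (_ : Pairwise fun i j => Disjoint (J i) (J j)),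
    ⋂ i, maxCyl (A i) (J i)

/-- The unit cube `[0,1]^d`. -/
abbrev Cube (d : ℕ) : Type := Fin d → unitInterval

/-- `m_d`: Lebesgue measure on the Borel sets of the unit cube `[0,1]^d`. -/
noncomputable abbrev m (d : ℕ) : Measure (Cube d) := volume

/-- A set is Lebesgue measurable when it belongs to the completion of the Borel sigma-algebra
with respect to `m_d`. -/
abbrev LebesgueMeasurable {d : ℕ} (A : Set (Cube d)) : Prop := NullMeasurableSet A (m d)

/-- `λ_d`: the completion of `m_d`, a measure on the Lebesgue measurable sets. -/
noncomputable abbrev lam (d : ℕ) : Measure (NullMeasurableSpace (Cube d) (m d)) :=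
  (m d).completion

end BKR

/-! Mixing the coordinates of two independent uniform points `p` gives a discrete cube of points
`mix s p`, each uniform and independent of its complementary mixture. On this cube Reimer's theorem
(`card_le_card_butterfly`, by linear algebra) bounds the number of mixtures in `box A B` by the
number lying in `A` with complementary mixture in `B`. Integrating over `p` gives `measure_box_le`,
and induction on `r` the general bound.

Measurability: the complement of `maxCyl A K` is a projection of a Borel set, hence analytic, hence
null measurable. Part 2 follows by passing to Borel hulls. -/

namespace BKR

/-! ### Reimer's butterfly theorem by determinants -/

section Discrete

variable {ι : Type*} [Fintype ι] [DecidableEq ι]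

/-- A square matrix with nonzero determinant and a zero block with rows `X` and columns outside
`T` satisfies `#X ≤ #T`. -/
theorem card_le_card_of_det_ne_zero {n R : Type*} [Fintype n] [DecidableEq n] [CommRing R]
    {M : Matrix n n R} (hM : M.det ≠ 0) {X T : Finset n}
    (h : ∀ x ∈ X, ∀ w ∉ T, M x w = 0) : X.card ≤ T.card := by
  rw [Matrix.det_apply] at hM
  -- A nonzero term of the Leibniz expansion avoids the zero block, so its permutation matches `X`
  -- injectively into `T`.
  obtain ⟨σ, -, hσ⟩ := Finset.exists_ne_zero_of_sum_ne_zero hM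
  refine Finset.card_le_card_of_injOn σ.symm (fun x hx => ?_) σ.symm.injective.injOn
  by_contra hw
  refine hσ ?_
  rw [Finset.prod_eq_zero (Finset.mem_univ (σ.symm x)), smul_zero]
  rw [σ.apply_symm_apply]
  exact h x hx _ hw

/-- Rows are the product vectors attached to the cubes of a flock of butterflies: the factor is
a basis vector in the directions of `J x`, and `(3, 2)` or `(2, 3)` elsewhere. -/
def bodyMatrix (J : (ι → Bool) → Finset ι) : Matrix (ι → Bool) (ι → Bool) ℤ :=
  fun x y => ∏ i, if i ∈ J x then (if x i = y i then 1 else 0) else (if x i = y i then 3 else 2)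

/-- Rows are basis vectors or product vectors with factors `(2, -3)` and `(-3, 2)`, according to
whether the index lies in `R`. -/
def testMatrix (R : Finset (ι → Bool)) : Matrix (ι → Bool) (ι → Bool) ℤ :=
  fun w y => ∏ i, if w ∈ R then (if w i = y i then 2 else -3) else (if w i = y i then 1 else 0)

theorem det_bodyMatrix_ne_zero (J : (ι → Bool) → Finset ι) : (bodyMatrix J).det ≠ 0 := by
  intro h
  -- Modulo 2 the factors `(3, 2)` and `(2, 3)` become basis vectors.
  have h2 : (Int.castRingHom (ZMod 2)).mapMatrix (bodyMatrix J) = 1 := by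
    ext x y
    simp only [RingHom.mapMatrix_apply, Matrix.map_apply, bodyMatrix, map_prod, Matrix.one_apply]
    split_ifs with hxy
    · subst hxy
      refine Finset.prod_eq_one fun i _ => ?_
      rw [if_pos rfl, if_pos rfl]
      split_ifs <;> (simp; try rfl)
    · obtain ⟨i, hi⟩ := Function.ne_iff.1 hxy
      refine Finset.prod_eq_zero (Finset.mem_univ i) ?_
      rw [if_neg hi, if_neg hi]
      split_ifs <;> (simp; try rfl)
  have := congrArg (Int.castRingHom (ZMod 2)) h
  rw [RingHom.map_det, h2, Matrix.det_one, map_zero] at this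
  exact one_ne_zero this

theorem det_testMatrix_ne_zero (R : Finset (ι → Bool)) : (testMatrix R).det ≠ 0 := by
  intro h
  have h2 : (2 : ZMod 3) ≠ 0 := by decide
  have : Fact (Nat.Prime 3) := ⟨Nat.prime_three⟩
  -- Modulo 3 the entry -3 vanishes and 2 is a unit.
  have h3 : (Int.castRingHom (ZMod 3)).mapMatrix (testMatrix R) =
      Matrix.diagonal fun w => ∏ _i : ι, if w ∈ R then (2 : ZMod 3) else 1 := by
    ext w y
    simp only [RingHom.mapMatrix_apply, Matrix.map_apply, testMatrix, map_prod,
      Matrix.diagonal_apply]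
    split_ifs with hR hwy hwy
    · subst hwy
      exact Finset.prod_congr rfl fun i _ => by simp
    · obtain ⟨i, hi⟩ := Function.ne_iff.1 hwy
      refine Finset.prod_eq_zero (Finset.mem_univ i) ?_
      rw [if_neg hi]
      simp only [eq_intCast]
      rfl
    · subst hwy
      exact Finset.prod_congr rfl fun i _ => by simp
    · obtain ⟨i, hi⟩ := Function.ne_iff.1 hwy
      refine Finset.prod_eq_zero (Finset.mem_univ i) ?_
      rw [if_neg hi, map_zero]
  have := congrArg (Int.castRingHom (ZMod 3)) h
  rw [RingHom.map_det, h3, Matrix.det_diagonal, map_zero] at this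
  refine Finset.prod_ne_zero_iff.2 (fun w _ => Finset.prod_ne_zero_iff.2 fun i _ => ?_) this
  split_ifs
  · exact h2
  · exact one_ne_zero

/-- The inner product of two product vectors factors over coordinates, so one orthogonal pair of
factors makes the entry zero. -/
theorem bodyMatrix_mul_testMatrix_transpose (J : (ι → Bool) → Finset ι)
    (R : Finset (ι → Bool)) (x w : ι → Bool) :
    (bodyMatrix J * (testMatrix R).transpose) x w =
      ∏ i, ∑ b : Bool,
        (if i ∈ J x then (if x i = b then (1 : ℤ) else 0) else (if x i = b then 3 else 2)) *
        (if w ∈ R then (if w i = b then 2 else -3) else (if w i = b then 1 else 0)) := by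
  rw [Matrix.mul_apply, Finset.prod_univ_sum, Fintype.piFinset_univ]
  refine Finset.sum_congr rfl fun y _ => ?_
  rw [Matrix.transpose_apply, bodyMatrix, testMatrix, Finset.prod_mul_distrib]

/-- **Reimer's butterfly theorem.** -/
theorem card_le_card_butterfly (X : Finset (ι → Bool)) (J : (ι → Bool) → Finset ι) :
    X.card ≤ (Finset.univ.filter fun w : ι → Bool =>
      (∃ x ∈ X, ∀ i ∈ J x, w i = x i) ∧ ∃ x ∈ X, ∀ i ∉ J x, w i = !x i).card := by
  classical
  set R : Finset (ι → Bool) := Finset.univ.filter fun w => ∃ x ∈ X, ∀ i ∈ J x, w i = x i with hR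
  have hdet : (bodyMatrix J * (testMatrix R).transpose).det ≠ 0 := by
    rw [Matrix.det_mul, Matrix.det_transpose]
    exact mul_ne_zero (det_bodyMatrix_ne_zero J) (det_testMatrix_ne_zero R)
  refine card_le_card_of_det_ne_zero hdet fun x hx w hw => ?_
  rw [bodyMatrix_mul_testMatrix_transpose]
  rw [Finset.mem_filter_univ, not_and] at hw
  -- For `w ∈ R`, some `i ∉ J x` has `w i = x i`, and there `(3, 2)` is orthogonal to `(2, -3)`, or
  -- `(2, 3)` to `(-3, 2)`. For `w ∉ R`, distinct basis vectors meet at some `i ∈ J x`.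
  by_cases hwR : w ∈ R
  · have h2 := hw (by simpa [hR] using hwR)
    push Not at h2
    obtain ⟨i, hi, hwi⟩ := h2 x hx
    refine Finset.prod_eq_zero (Finset.mem_univ i) ?_
    have hwi' : w i = x i := by simpa using hwi
    simp only [hi, hwR, hwi', Fintype.sum_bool]
    cases x i <;> simp
  · have h2 : ¬ ∃ x ∈ X, ∀ i ∈ J x, w i = x i := by simpa [hR] using hwR
    push Not at h2
    obtain ⟨i, hi, hwi⟩ := h2 x hx
    refine Finset.prod_eq_zero (Finset.mem_univ i) ?_
    simp only [hi, hwR, Fintype.sum_bool]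
    revert hwi
    cases x i <;> cases w i <;> simp

end Discrete

/-! ### Two-fold products and mixtures of points -/

/-- The two-fold product of `A` and `B`. -/
def box {S : Type*} {d : ℕ} (A B : Set (Fin d → S)) : Set (Fin d → S) :=
  ⋃ J : Finset (Fin d), maxCyl A J ∩ maxCyl B Jᶜ

theorem maxCyl_subset {S : Type*} {d : ℕ} (A : Set (Fin d → S)) (K : Finset (Fin d)) :
    maxCyl A K ⊆ A :=
  fun _ h => h fun _ _ => rfl

theorem maxCyl_mono {S : Type*} {d : ℕ} {A B : Set (Fin d → S)} (hAB : A ⊆ B)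
    {K L : Finset (Fin d)} (hKL : K ⊆ L) : maxCyl A K ⊆ maxCyl B L :=
  fun _ h _ hω' => hAB (h fun i hi => hω' i (hKL hi))

theorem bkr_mono {S : Type*} {d r : ℕ} {A B : Fin r → Set (Fin d → S)} (h : ∀ i, A i ⊆ B i) :
    bkr A ⊆ bkr B :=
  Set.iUnion₂_mono fun _ _ => Set.iInter_mono fun i => maxCyl_mono (h i) subset_rfl

/-- The sets `J i.succ` all lie in the complement of `J 0`, so they still witness the remaining
product along the whole cylinder over that complement. -/
theorem bkr_succ_subset_box {S : Type*} {d r : ℕ} (A : Fin (r + 1) → Set (Fin d → S)) :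
    bkr A ⊆ box (A 0) (bkr fun i => A i.succ) := by
  intro ω hω
  simp only [bkr, Set.mem_iUnion, Set.mem_iInter] at hω
  obtain ⟨J, hJ, h⟩ := hω
  refine Set.mem_iUnion.2 ⟨J 0, h 0, fun ω' hω' => ?_⟩
  simp only [bkr, Set.mem_iUnion, Set.mem_iInter]
  refine ⟨fun i => J i.succ, fun i j hij => hJ fun e => hij (Fin.succ_injective _ e),
    fun i ω'' h'' => h i.succ fun k hk => ?_⟩
  rw [h'' k hk, hω' k]
  exact Finset.mem_compl.2 (Finset.disjoint_right.1 (hJ (Fin.succ_ne_zero i).symm) hk)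

/-- The point taking coordinate `i` from `p.1` or from `p.2` according to `s i`. -/
def mix {S : Type*} {d : ℕ} (s : Fin d → Bool) (p : (Fin d → S) × (Fin d → S)) : Fin d → S :=
  fun i => if s i then p.1 i else p.2 i

-- Agreeing with `s` on `J s` keeps a mixture in `A`; being opposite to `s` off `J s` puts the
-- complementary mixture in `B`.
open scoped Classical in
theorem card_mix_mem_box_le {S : Type*} {d : ℕ} (A B : Set (Fin d → S))
    (p : (Fin d → S) × (Fin d → S)) :
    (Finset.univ.filter fun s : Fin d → Bool => mix s p ∈ box A B).card ≤
      (Finset.univ.filter fun s : Fin d → Bool =>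
        mix s p ∈ A ∧ mix (fun i => !s i) p ∈ B).card := by
  have hJ : ∀ s : Fin d → Bool, ∃ J : Finset (Fin d), mix s p ∈ box A B →
      mix s p ∈ maxCyl A J ∧ mix s p ∈ maxCyl B Jᶜ := fun s => by
    by_cases h : mix s p ∈ box A B
    · obtain ⟨J, hJ⟩ := Set.mem_iUnion.1 h
      exact ⟨J, fun _ => hJ⟩
    · exact ⟨∅, fun h' => (h h').elim⟩
  choose J hJ using hJ
  refine (card_le_card_butterfly _ J).trans (Finset.card_le_card fun w hw => ?_)
  simp only [Finset.mem_filter_univ] at hw ⊢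
  obtain ⟨⟨x, hx, hwx⟩, y, hy, hwy⟩ := hw
  refine ⟨(hJ x hx).1 fun i hi => by simp only [mix, hwx i hi], (hJ y hy).2 fun i hi => ?_⟩
  simp only [mix, hwy i (Finset.mem_compl.1 hi), Bool.not_not]


/-! ### Null measurability of analytic sets -/

open Filter Topology
open scoped ENNReal

/-- The sequences whose first `k` terms are bounded by those of `n`. -/
def initBox (n : ℕ → ℕ) (k : ℕ) : Set (ℕ → ℕ) :=
  {x | ∀ i < k, x i ≤ n i}

theorem exists_initBox_subset {n : ℕ → ℕ} {V : Set (ℕ → ℕ)} (hV : IsOpen V)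
    (h : Set.Iic n ⊆ V) : ∃ k, initBox n k ⊆ V := by
  by_contra! hk
  simp only [Set.not_subset] at hk
  choose x hx hxV using hk
  have hK : IsCompact (Set.Iic n) := by
    have := isCompact_univ_pi fun i => (Set.finite_Iic (n i)).isCompact
    rwa [Set.pi_univ_Iic] at this
  obtain ⟨a, ha, φ, hφ, hlim⟩ := hK.tendsto_subseq (x := fun k => x k ⊓ n)
    fun k => (inf_le_right : x k ⊓ n ≤ n)
  -- Truncating by `n` leaves the first `φ k` terms of `x (φ k)` unchanged, so each coordinate has
  -- the same limit.
  have hlim' : Tendsto (fun k => x (φ k)) atTop (𝓝 a) := by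
    rw [tendsto_pi_nhds] at hlim ⊢
    refine fun i => (hlim i).congr' ?_
    filter_upwards [eventually_gt_atTop i] with k hk
    exact min_eq_left (hx (φ k) i (hk.trans_le (hφ.id_le k)))
  obtain ⟨k, hk⟩ := (hlim'.eventually (hV.mem_nhds (h ha))).exists
  exact hxV _ hk

/-- The bounds are chosen one coordinate at a time, by continuity of `μ` from below. -/
theorem exists_forall_lt_measure_image_initBox {X : Type*} [MeasurableSpace X] (μ : Measure X)
    (f : (ℕ → ℕ) → X) {c : ℝ≥0∞} (hc : c < μ (Set.range f)) :
    ∃ n : ℕ → ℕ, ∀ k, c < μ (f '' initBox n k) := by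
  have step : ∀ k n, c < μ (f '' initBox n k) →
      ∃ l, c < μ (f '' initBox (Function.update n k l) (k + 1)) := by
    intro k n h
    have hmono : Monotone fun l => f '' initBox (Function.update n k l) (k + 1) := by
      intro a b hab
      refine Set.image_mono fun x hx i hi => (hx i hi).trans ?_
      exact update_le_update_iff.2 ⟨hab, fun _ _ => le_rfl⟩ i
    have hU : f '' initBox n k ⊆ ⋃ l, f '' initBox (Function.update n k l) (k + 1) := by
      rintro _ ⟨x, hx, rfl⟩
      refine Set.mem_iUnion.2 ⟨x k, x, fun i hi => ?_, rfl⟩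
      rcases Nat.lt_succ_iff_lt_or_eq.1 hi with hi | rfl
      · rw [Function.update_of_ne hi.ne]
        exact hx i hi
      · rw [Function.update_self]
    exact lt_iSup_iff.1 (hmono.measure_iUnion (μ := μ) ▸ h.trans_le (measure_mono hU))
  choose! l hl using step
  let g : ℕ → ℕ → ℕ := fun k => Nat.rec 0 (fun k n => Function.update n k (l k n)) k
  have hg : ∀ k, c < μ (f '' initBox (g k) k) := by
    intro k
    induction k with
    | zero =>
      have : initBox (g 0) 0 = Set.univ := by simp [initBox]
      rwa [this, Set.image_univ]
    | succ k ih => exact hl k _ ih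
  have hstable : ∀ i k, i < k → g k i = g (i + 1) i := by
    intro i k hik
    induction k, hik using Nat.le_induction with
    | base => rfl
    | succ k hk ih => rw [← ih]; exact Function.update_of_ne (Nat.ne_of_lt hk) _ _
  refine ⟨fun i => g (i + 1) i, fun k => ?_⟩
  have : initBox (fun i => g (i + 1) i) k = initBox (g k) k := by
    ext x
    exact forall₂_congr fun i hi => by rw [hstable i k hi]
  rw [this]
  exact hg k

/-- Analytic sets are measurable for the completion of every finite Borel measure. -/
theorem nullMeasurableSet_of_analyticSet {X : Type*} [TopologicalSpace X] [T2Space X]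
    [MeasurableSpace X] [OpensMeasurableSpace X] {μ : Measure X} [IsFiniteMeasure μ]
    [μ.OuterRegular] {s : Set X} (hs : AnalyticSet s) : NullMeasurableSet s μ := by
  rw [AnalyticSet] at hs
  obtain rfl | ⟨f, hf, rfl⟩ := hs
  · exact .empty
  -- Inner approximation by compact images: every open set around `f '' Set.Iic n` already contains
  -- some `f '' initBox n k`.
  have key : ∀ c < μ (Set.range f), ∃ t ⊆ Set.range f, MeasurableSet t ∧ c ≤ μ t := by
    intro c hc
    obtain ⟨n, hn⟩ := exists_forall_lt_measure_image_initBox μ f hc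
    have hK : IsCompact (Set.Iic n) := by
      have := isCompact_univ_pi fun i => (Set.finite_Iic (n i)).isCompact
      rwa [Set.pi_univ_Iic] at this
    refine ⟨f '' Set.Iic n, Set.image_subset_range _ _, (hK.image hf).measurableSet, ?_⟩
    rw [Set.measure_eq_iInf_isOpen]
    refine le_iInf₂ fun U hU => le_iInf fun hUo => ?_
    obtain ⟨k, hk⟩ := exists_initBox_subset (hUo.preimage hf) (Set.image_subset_iff.1 hU)
    exact (hn k).le.trans (measure_mono (Set.image_subset_iff.2 hk))
  obtain h0 | h0 := eq_or_ne (μ (Set.range f)) 0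
  · exact .of_null h0
  obtain ⟨u, -, hu, hlim⟩ := exists_seq_strictMono_tendsto' (pos_iff_ne_zero.2 h0)
  choose t htf htm hut using fun k => key (u k) (hu k).2
  have hsub : ⋃ k, t k ⊆ Set.range f := Set.iUnion_subset htf
  have hle : μ (Set.range f) ≤ μ (⋃ k, t k) :=
    le_of_tendsto' hlim fun k => (hut k).trans (measure_mono (Set.subset_iUnion t k))
  have hae := ae_eq_of_subset_of_measure_ge hsub hle
    (MeasurableSet.iUnion htm).nullMeasurableSet (measure_ne_top μ _)
  exact (MeasurableSet.iUnion htm).nullMeasurableSet.congr hae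

/-! ### Measurability and the inequality on the unit cube -/

theorem nullMeasurableSet_maxCyl {d : ℕ} {A : Set (Cube d)} (hA : MeasurableSet A)
    (K : Finset (Fin d)) : NullMeasurableSet (maxCyl A K) (m d) := by
  have h : (maxCyl A K)ᶜ =
      Prod.fst '' {p : Cube d × Cube d | (∀ i ∈ K, p.2 i = p.1 i) ∧ p.2 ∈ Aᶜ} := by
    ext ω
    simp [maxCyl, cyl, Set.subset_def]
  have hm : MeasurableSet {p : Cube d × Cube d | (∀ i ∈ K, p.2 i = p.1 i) ∧ p.2 ∈ Aᶜ} := by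
    refine MeasurableSet.inter (s₁ := {p : Cube d × Cube d | ∀ i ∈ K, p.2 i = p.1 i}) ?_
      (measurable_snd hA.compl)
    simp only [Set.ofPred_forall]
    exact K.measurableSet_biInter fun i _ => measurableSet_eq_fun (by fun_prop) (by fun_prop)
  rw [← compl_compl (maxCyl A K), h]
  exact (nullMeasurableSet_of_analyticSet
    (hm.analyticSet.image_of_continuous continuous_fst)).compl

theorem nullMeasurableSet_box {d : ℕ} {A B : Set (Cube d)} (hA : MeasurableSet A)
    (hB : MeasurableSet B) : NullMeasurableSet (box A B) (m d) :=
  .iUnion fun J => (nullMeasurableSet_maxCyl hA J).inter (nullMeasurableSet_maxCyl hB Jᶜ)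

theorem nullMeasurableSet_bkr {d r : ℕ} {A : Fin r → Set (Cube d)}
    (hA : ∀ i, MeasurableSet (A i)) : NullMeasurableSet (bkr A) (m d) :=
  .iUnion fun J => .iUnion fun _ => .iInter fun i => nullMeasurableSet_maxCyl (hA i) (J i)

/-- On each coordinate pair the map is the identity or the swap. -/
theorem measurePreserving_mix_prod (d : ℕ) (s : Fin d → Bool) :
    MeasurePreserving (fun p : Cube d × Cube d => (mix s p, mix (fun i => !s i) p))
      ((m d).prod (m d)) ((m d).prod (m d)) := by
  have e := volume_measurePreserving_arrowProdEquivProdArrow unitInterval unitInterval (Fin d)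
  have hswap : MeasurePreserving
      (fun (q : Fin d → unitInterval × unitInterval) i => (bif s i then id else Prod.swap) (q i))
      volume volume := by
    refine volume_preserving_pi fun i => ?_
    cases s i
    · exact Measure.measurePreserving_swap
    · exact .id _
  have h := (e.comp hswap).comp (e.symm _)
  refine (congrArg (fun f => MeasurePreserving f volume volume) ?_).mp h
  ext p i <;> cases h : s i <;>
    simp [mix, h, MeasurableEquiv.arrowProdEquivProdArrow, Equiv.arrowProdEquivProdArrow]

theorem measure_box_le {d : ℕ} {A B : Set (Cube d)} (hA : MeasurableSet A)
    (hB : MeasurableSet B) : m d (box A B) ≤ m d A * m d B := by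
  classical
  have hbox (s : Fin d → Bool) : MeasurePreserving (mix s) ((m d).prod (m d)) (m d) :=
    measurePreserving_fst.comp (measurePreserving_mix_prod d s)
  have hn (s : Fin d → Bool) : NullMeasurableSet (mix s ⁻¹' box A B) ((m d).prod (m d)) :=
    (nullMeasurableSet_box hA hB).preimage (hbox s).quasiMeasurePreserving
  have hpm (s : Fin d → Bool) : MeasurableSet ((fun p : Cube d × Cube d =>
      (mix s p, mix (fun i => !s i) p)) ⁻¹' (A ×ˢ B)) :=
    (measurePreserving_mix_prod d s).measurable (hA.prod hB)
  have hint : ∑ s : Fin d → Bool, (m d).prod (m d) (mix s ⁻¹' box A B) ≤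
      ∑ s : Fin d → Bool, (m d).prod (m d) ((fun p : Cube d × Cube d =>
        (mix s p, mix (fun i => !s i) p)) ⁻¹' (A ×ˢ B)) := by
    simp only [← lintegral_indicator_one₀ (hn _), ← lintegral_indicator_one (hpm _)]
    have hn1 (s : Fin d → Bool) : AEMeasurable
        ((mix s ⁻¹' box A B).indicator (1 : Cube d × Cube d → ℝ≥0∞))
        ((m d).prod (m d)) := aemeasurable_const.indicator₀ (hn s)
    rw [← lintegral_finsetSum' _ fun s _ => hn1 s,
      ← lintegral_finsetSum _ fun s _ => measurable_one.indicator (hpm s)]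
    refine lintegral_mono fun p => ?_
    simp only [Set.indicator_apply, Set.mem_preimage, Set.mem_prod, Pi.one_apply,
      Finset.sum_boole]
    exact_mod_cast card_mix_mem_box_le A B p
  simp only [fun s => (hbox s).measure_preimage (nullMeasurableSet_box hA hB),
    fun s => (measurePreserving_mix_prod d s).measure_preimage (hA.prod hB).nullMeasurableSet,
    Measure.prod_prod, Finset.sum_const, nsmul_eq_mul] at hint
  exact (ENNReal.mul_le_mul_iff_right (by simp) (by simp)).1 hint

theorem measure_bkr_le {d r : ℕ} {A : Fin r → Set (Cube d)} (hA : ∀ i, MeasurableSet (A i)) :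
    m d (bkr A) ≤ ∏ i, m d (A i) := by
  induction r with
  | zero => simpa using prob_le_one
  | succ r ih =>
    -- The tail product need not be Borel, as the two-fold bound requires; its hull is, with the
    -- same measure.
    set D := toMeasurable (m d) (bkr fun i => A i.succ)
    calc m d (bkr A) ≤ m d (box (A 0) D) :=
          measure_mono <| (bkr_succ_subset_box A).trans <| Set.iUnion_mono fun _ =>
            Set.inter_subset_inter_right _ <| maxCyl_mono (subset_toMeasurable _ _) subset_rfl
      _ ≤ m d (A 0) * m d D := measure_box_le (hA 0) (measurableSet_toMeasurable _ _)
      _ ≤ m d (A 0) * ∏ i : Fin r, m d (A i.succ) := by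
          rw [measure_toMeasurable]
          gcongr
          exact ih fun i => hA i.succ
      _ = ∏ i, m d (A i) := (Fin.prod_univ_succ fun i => m d (A i)).symm

end BKR

theorem mainTheorem3 (d r : ℕ) :
    (∀ A : Fin r → Set (BKR.Cube d), (∀ i, MeasurableSet (A i)) →
      BKR.LebesgueMeasurable (BKR.bkr A) ∧
        BKR.lam d (BKR.bkr A) ≤ ∏ i, BKR.m d (A i)) ∧
    (∀ A : Fin r → Set (BKR.Cube d), (∀ i, BKR.LebesgueMeasurable (A i)) →
      ∃ D : Set (BKR.Cube d), MeasurableSet D ∧ BKR.bkr A ⊆ D ∧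
        BKR.m d D ≤ ∏ i, BKR.lam d (A i)) := by
  refine ⟨fun A hA => ⟨BKR.nullMeasurableSet_bkr hA, BKR.measure_bkr_le hA⟩, fun A _ => ?_⟩
  refine ⟨toMeasurable (BKR.m d) (BKR.bkr fun i => toMeasurable (BKR.m d) (A i)),
    measurableSet_toMeasurable _ _,
    (BKR.bkr_mono fun i => subset_toMeasurable _ _).trans (subset_toMeasurable _ _), ?_⟩
  rw [measure_toMeasurable]
  refine (BKR.measure_bkr_le fun i => measurableSet_toMeasurable _ _).trans_eq ?_
  simp only [measure_toMeasurable, Measure.completion_apply]
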